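/- Let $G$ be a connected simple graph (finite or infinite), regarded as a metric graph: every edge has length $1$, the interior points of edges are points of $G$, and the distance between two points is the length of a shortest path joining them. A *tree* is a connected graph without cycles, regarded as a metric graph in the same way. Metric spaces $X,Y$ are *quasi-isometric* if there are a map $f:X\to Y$ and constants $\lambda\ge 1$, $c>0$, $D>0$ such that $\frac1\lambda d_X(x,x')-c\le d_Y(f(x),f(x'))\le \lambda d_X(x,x')+c$ for all $x,x'\in X$ and every point of $Y$ is at distance at most $D$ from $f(X)$. For a cycle $C$ of $G$ (a simple closed curve made of edges), let $L(C)$ be its length and $d_C$ its length metric. A *strict shortcut* in $C$ is a simple path $\sigma$ in $G$ joining two vertices $p,q$ of $C$ with length $L(\sigma)<d_C(p,q)$ and $\sigma\cap C=\{p,q\}$; then $p,q$ are the *shortcut vertices* associated to $\sigma$. For $\varepsilon>0$ and $k,m\in\mathbb N$ with $k\ge 4$ and $k\ge 2m$, the graph $G$ is *$\varepsilon$-densely $(k,m)$-chordal* if for every cycle $C$ with $L(C)\ge k$ there are strict shortcuts $\sigma_1,\dots,\sigma_r$ in $C$ with $L(\sigma_i)\le m$ for all $i$, whose associated shortcut vertices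 form an $\varepsilon$-dense subset of $(C,d_C)$, i.e. every point $x$ of $C$ (including the interior points of its edges) has $d_C(x,v)<\varepsilon$ for one of these vertices $v$. **Corollary.** $G$ is quasi-isometric to a tree if and only if there are $\varepsilon>0$ and $k,m\in\mathbb N$ with $k\ge 4$ and $k\ge 2m$ such that $G$ is $\varepsilon$-densely $(k,m)$-chordal. -/

import Mathlib

/-! ### Metric graphs -/

open Classical in
/-- The points of a graph in which the interior points of the edges count as points: the geometric
realization of `G` in barycentric coordinates. A vertex `v` is the function `Pi.single v 1`, and
the edge `uv` is the segment between the vertices `u` and `v`. -/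
def graphPoints {V : Type*} (G : SimpleGraph V) : Set (V → ℝ) :=
  {x | ∃ u v, (u = v ∨ G.Adj u v) ∧
    x ∈ segment ℝ (Pi.single u (1 : ℝ) : V → ℝ) (Pi.single v (1 : ℝ))}

/-- The connected graph `G` as a metric graph all of whose edges have length one. -/
@[nolint unusedArguments]
def MetricGraph {V : Type*} (G : SimpleGraph V) (_hG : G.Connected) : Type _ :=
  graphPoints G

namespace MetricGraph

variable {V : Type*} {G : SimpleGraph V} {hG : G.Connected}

/-- The barycentric coordinates of a point. -/
def coord (x : MetricGraph G hG) : V → ℝ := x.1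

/-- The lengths of the candidates for a shortest path from `x` to `y`: either the path leaves `x`
along its edge towards an end `u`, follows a shortest path of edges from `u` to an end `v` of the
edge of `y`, and then moves along that edge to `y`; or `x` and `y` lie on a common edge `uv`, and
the path is the segment between them. -/
def pathLengths (x y : MetricGraph G hG) : Set ℝ :=
  {r | (∃ u v, 0 < x.coord u ∧ 0 < y.coord v ∧
          r = (1 - x.coord u) + (G.dist u v : ℝ) + (1 - y.coord v)) ∨
       (∃ u v, G.Adj u v ∧ x.coord u + x.coord v = 1 ∧ y.coord u + y.coord v = 1 ∧
          r = |x.coord u - y.coord u|)}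

/-- The distance is the length of a shortest path. -/
noncomputable instance : Dist (MetricGraph G hG) := ⟨fun x y => sInf (pathLengths x y)⟩

theorem dist_def (x y : MetricGraph G hG) : dist x y = sInf (pathLengths x y) := rfl

theorem coord_cases (x : MetricGraph G hG) :
    (∃ u, x.coord u = 1 ∧ ∀ w, w ≠ u → x.coord w = 0) ∨
    (∃ u v, G.Adj u v ∧ 0 ≤ x.coord u ∧ 0 ≤ x.coord v ∧ x.coord u + x.coord v = 1 ∧
      ∀ w, w ≠ u → w ≠ v → x.coord w = 0) := by
  classical
  obtain ⟨x, u, v, huv, a, b, ha, hb, hab, rfl⟩ := x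
  simp only [coord]
  rcases huv with rfl | huv
  · left
    refine ⟨u, by simpa using hab, fun w hw => by simp [hw]⟩
  · right
    have := huv.ne
    refine ⟨u, v, huv, ?_, ?_, ?_, fun w hw hw' => by simp [hw, hw']⟩
    · simpa [this] using ha
    · simpa [this.symm] using hb
    · simpa [this, this.symm] using hab

theorem coord_nonneg (x : MetricGraph G hG) (w : V) : 0 ≤ x.coord w := by
  rcases x.coord_cases with ⟨u, hu, h⟩ | ⟨u, v, -, hu, hv, -, h⟩
  · by_cases hw : w = u <;> grind
  · by_cases hw : w = u <;> by_cases hw' : w = v <;> grind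

theorem exists_coord_pos (x : MetricGraph G hG) : ∃ u, 0 < x.coord u := by
  rcases x.coord_cases with ⟨u, hu, h⟩ | ⟨u, v, -, hu, hv, h1, -⟩
  · exact ⟨u, by linarith⟩
  · by_cases h : 0 < x.coord u
    · exact ⟨u, h⟩
    · exact ⟨v, by linarith⟩

theorem coord_le_one (x : MetricGraph G hG) (w : V) : x.coord w ≤ 1 := by
  rcases x.coord_cases with ⟨u, hu, h⟩ | ⟨u, v, -, hu, hv, h1, h⟩
  · by_cases hw : w = u <;> grind
  · by_cases hw : w = u <;> by_cases hw' : w = v <;> grind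

theorem adj_of_coord_pos (x : MetricGraph G hG) {u v : V} (hu : 0 < x.coord u)
    (hv : 0 < x.coord v) (huv : u ≠ v) : G.Adj u v ∧ x.coord u + x.coord v = 1 := by
  rcases x.coord_cases with ⟨a, ha, h⟩ | ⟨a, b, hab, ha, hb, h1, h⟩
  · by_cases hua : u = a <;> by_cases hva : v = a <;> grind
  · have := hab.symm
    by_cases hua : u = a <;> by_cases hva : v = a <;> by_cases hub : u = b <;>
      by_cases hvb : v = b <;> grind

theorem coord_eq_zero (x : MetricGraph G hG) {u v w : V} (huv : u ≠ v)
    (h : x.coord u + x.coord v = 1) (hu : w ≠ u) (hv : w ≠ v) : x.coord w = 0 := by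
  rcases x.coord_cases with ⟨a, ha, h⟩ | ⟨a, b, hab, ha, hb, h1, h⟩
  · by_cases hua : u = a <;> by_cases hva : v = a <;> by_cases hwa : w = a <;> grind
  · by_cases hua : u = a <;> by_cases hva : v = a <;> by_cases hwa : w = a <;>
      by_cases hub : u = b <;> by_cases hvb : v = b <;> by_cases hwb : w = b <;> grind

theorem pathLengths_nonneg (x y : MetricGraph G hG) : ∀ r ∈ pathLengths x y, 0 ≤ r := by
  rintro r (⟨u, v, -, -, rfl⟩ | ⟨u, v, -, -, -, rfl⟩)
  · have h1 := x.coord_le_one u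
    have h2 := y.coord_le_one v
    have h3 : (0 : ℝ) ≤ G.dist u v := by positivity
    linarith
  · positivity

theorem pathLengths_nonempty (x y : MetricGraph G hG) : (pathLengths x y).Nonempty := by
  obtain ⟨u, hu⟩ := x.exists_coord_pos
  obtain ⟨v, hv⟩ := y.exists_coord_pos
  exact ⟨_, Or.inl ⟨u, v, hu, hv, rfl⟩⟩

theorem dist_le_of_mem {x y : MetricGraph G hG} {r : ℝ} (h : r ∈ pathLengths x y) :
    dist x y ≤ r :=
  csInf_le ⟨0, fun r hr => pathLengths_nonneg x y r hr⟩ h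

theorem mem_pathLengths_symm {x y : MetricGraph G hG} {r : ℝ} (h : r ∈ pathLengths x y) :
    r ∈ pathLengths y x := by
  rcases h with ⟨u, v, hu, hv, rfl⟩ | ⟨u, v, huv, hx, hy, rfl⟩
  · exact Or.inl ⟨v, u, hv, hu, by rw [G.dist_comm]; ring⟩
  · exact Or.inr ⟨u, v, huv, hy, hx, abs_sub_comm _ _⟩

theorem exists_near (x : MetricGraph G hG) {p q : V} (hpq : G.Adj p q)
    (h : x.coord p + x.coord q = 1) :
    ∃ u, 0 < x.coord u ∧ (1 - x.coord u) + (G.dist u p : ℝ) ≤ 1 - x.coord p := by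
  by_cases hp : 0 < x.coord p
  · exact ⟨p, hp, by simp⟩
  · have h0 : x.coord p = 0 := le_antisymm (not_lt.1 hp) (x.coord_nonneg p)
    refine ⟨q, by linarith, ?_⟩
    rw [SimpleGraph.dist_eq_one_iff_adj.2 hpq.symm]
    push_cast
    linarith

theorem exists_common_end (x : MetricGraph G hG) {p q u : V} (hpq : G.Adj p q)
    (h : x.coord p + x.coord q = 1) (hu : 0 < x.coord u) :
    ∃ q', G.Adj u q' ∧ (u = p ∧ q' = q ∨ u = q ∧ q' = p) := by
  by_cases hp : u = p
  · exact ⟨q, hp ▸ hpq, Or.inl ⟨hp, rfl⟩⟩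
  · by_cases hq : u = q
    · exact ⟨p, hq ▸ hpq.symm, Or.inr ⟨hq, rfl⟩⟩
    · exact absurd (x.coord_eq_zero hpq.ne h hp hq) hu.ne'

theorem dist_triangle_real (u v w : V) (hG : G.Connected) :
    (G.dist u w : ℝ) ≤ G.dist u v + G.dist v w := by
  exact_mod_cast hG.dist_triangle

theorem exists_via_direct {x y z : MetricGraph G hG} {u v p q : V} (hu : 0 < x.coord u)
    (hv : 0 < y.coord v) (hpq : G.Adj p q) (hy : y.coord p + y.coord q = 1)
    (hz : z.coord p + z.coord q = 1) :
    ∃ t ∈ pathLengths x z, t ≤ (1 - x.coord u) + (G.dist u v : ℝ) + (1 - y.coord v) +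
      |y.coord p - z.coord p| := by
  have key : (1 - z.coord v) ≤ (1 - y.coord v) + |y.coord p - z.coord p| ∧
      ∃ w, 0 < z.coord w ∧ (1 - z.coord w) + (G.dist w v : ℝ) ≤ 1 - z.coord v := by
    obtain ⟨q', -, ⟨rfl, rfl⟩ | ⟨rfl, rfl⟩⟩ := y.exists_common_end hpq hy hv
    · exact ⟨by linarith [le_abs_self (y.coord v - z.coord v)], z.exists_near hpq hz⟩
    · exact ⟨by linarith [neg_abs_le (y.coord q' - z.coord q')],
        z.exists_near hpq.symm (by linarith)⟩
  obtain ⟨h1, w, hw, h2⟩ := key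
  refine ⟨_, Or.inl ⟨u, w, hu, hw, rfl⟩, ?_⟩
  have h3 := dist_triangle_real u v w hG
  rw [G.dist_comm (u := v)] at h3
  linarith

theorem exists_pathLengths_le {x y z : MetricGraph G hG} {r s : ℝ} (hr : r ∈ pathLengths x y)
    (hs : s ∈ pathLengths y z) : ∃ t ∈ pathLengths x z, t ≤ r + s := by
  rcases hr with ⟨u, v, hu, hv, rfl⟩ | ⟨p, q, hpq, hx, hy, rfl⟩
  · rcases hs with ⟨v', w, hv', hw, rfl⟩ | ⟨p, q, hpq, hy, hz, rfl⟩
    · refine ⟨_, Or.inl ⟨u, w, hu, hw, rfl⟩, ?_⟩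
      have h1 := dist_triangle_real u v w hG
      have h2 := dist_triangle_real v v' w hG
      have h3 : (G.dist v v' : ℝ) ≤ (1 - y.coord v) + (1 - y.coord v') := by
        by_cases h : v = v'
        · subst h
          simp only [SimpleGraph.dist_self, Nat.cast_zero]
          linarith [y.coord_le_one v]
        · obtain ⟨ha, hb⟩ := y.adj_of_coord_pos hv hv' h
          rw [SimpleGraph.dist_eq_one_iff_adj.2 ha]
          push_cast
          linarith
      linarith
    · exact exists_via_direct hu hv hpq hy hz
  · rcases hs with ⟨v, w, hv, hw, rfl⟩ | ⟨p', q', hpq', hy', hz, rfl⟩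
    · obtain ⟨t, ht, h⟩ := exists_via_direct (x := z) (y := y) (z := x) hw hv hpq hy hx
      refine ⟨t, mem_pathLengths_symm ht, ?_⟩
      rw [G.dist_comm, abs_sub_comm (x.coord p)]
      linarith
    · by_cases hsame : p' = p ∧ q' = q ∨ p' = q ∧ q' = p
      · refine ⟨_, Or.inr ⟨p, q, hpq, hx, ?_, rfl⟩, ?_⟩
        · rcases hsame with ⟨rfl, rfl⟩ | ⟨rfl, rfl⟩ <;> linarith
        · have h1 : |y.coord p' - z.coord p'| = |y.coord p - z.coord p| := by
            rcases hsame with ⟨rfl, rfl⟩ | ⟨rfl, rfl⟩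
            · rfl
            · rw [show y.coord p' - z.coord p' = -(y.coord q' - z.coord q') by linarith, abs_neg]
          rw [h1]
          exact abs_sub_le _ _ _
      · obtain ⟨v, hv⟩ := y.exists_coord_pos
        have hv1 : y.coord v = 1 := by
          have h1 := hpq.ne
          have h2 := hpq'.ne
          have h3 := fun w => y.coord_eq_zero (w := w) h1 hy
          have h4 := fun w => y.coord_eq_zero (w := w) h2 hy'
          by_cases e1 : v = p <;> by_cases e2 : v = q <;> by_cases e3 : v = p' <;>
            by_cases e4 : v = q' <;> by_cases e5 : p = p' <;> by_cases e6 : p = q' <;>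
            by_cases e7 : q = p' <;> by_cases e8 : q = q' <;> grind
        have a1 : 1 - x.coord v ≤ |x.coord p - y.coord p| ∧
            ∃ w, 0 < x.coord w ∧ (1 - x.coord w) + (G.dist w v : ℝ) ≤ 1 - x.coord v := by
          obtain ⟨b, -, ⟨rfl, rfl⟩ | ⟨rfl, rfl⟩⟩ := y.exists_common_end hpq hy hv
          · exact ⟨by linarith [neg_abs_le (x.coord v - y.coord v)], x.exists_near hpq hx⟩
          · exact ⟨by linarith [le_abs_self (x.coord b - y.coord b)],
              x.exists_near hpq.symm (by linarith)⟩
        have a2 : 1 - z.coord v ≤ |y.coord p' - z.coord p'| ∧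
            ∃ w, 0 < z.coord w ∧ (1 - z.coord w) + (G.dist w v : ℝ) ≤ 1 - z.coord v := by
          obtain ⟨b, -, ⟨rfl, rfl⟩ | ⟨rfl, rfl⟩⟩ := y.exists_common_end hpq' hy' hv
          · exact ⟨by linarith [le_abs_self (y.coord v - z.coord v)], z.exists_near hpq' hz⟩
          · exact ⟨by linarith [neg_abs_le (y.coord b - z.coord b)],
              z.exists_near hpq'.symm (by linarith)⟩
        obtain ⟨a1, u, hu, a3⟩ := a1
        obtain ⟨a2, w, hw, a4⟩ := a2
        refine ⟨_, Or.inl ⟨u, w, hu, hw, rfl⟩, ?_⟩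
        have h3 := dist_triangle_real u v w hG
        rw [G.dist_comm (u := v)] at h3
        linarith

theorem finite_coord_pos (x : MetricGraph G hG) : {u | 0 < x.coord u}.Finite := by
  rcases x.coord_cases with ⟨u, hu, h⟩ | ⟨u, v, -, hu, hv, -, h⟩
  · exact (Set.finite_singleton u).subset fun w hw => by
      by_contra h'
      exact (ne_of_gt hw) (h w h')
  · exact (Set.toFinite {u, v}).subset fun w hw => by
      by_contra h'
      simp only [Set.mem_insert_iff, Set.mem_singleton_iff, not_or] at h'
      exact (ne_of_gt hw) (h w h'.1 h'.2)

theorem dist_mem (x y : MetricGraph G hG) : dist x y ∈ pathLengths x y := by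
  refine (pathLengths_nonempty x y).csInf_mem ?_
  have h1 : ((fun a : V × V => (1 - x.coord a.1) + (G.dist a.1 a.2 : ℝ) + (1 - y.coord a.2)) ''
      ({u | 0 < x.coord u} ×ˢ {v | 0 < y.coord v})).Finite :=
    (x.finite_coord_pos.prod y.finite_coord_pos).image _
  obtain ⟨p, hp⟩ := x.exists_coord_pos
  have h2 : ({|x.coord p - y.coord p|} : Set ℝ).Finite := Set.finite_singleton _
  refine (h1.union h2).subset ?_
  rintro r (⟨u, v, hu, hv, rfl⟩ | ⟨u, v, huv, hx, hy, rfl⟩)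
  · exact Or.inl ⟨(u, v), ⟨hu, hv⟩, rfl⟩
  · right
    obtain ⟨b, -, ⟨rfl, rfl⟩ | ⟨rfl, rfl⟩⟩ := x.exists_common_end huv hx hp
    · rfl
    · rw [Set.mem_singleton_iff, ← abs_neg]
      congr 1
      linarith

theorem ext_coord {x y : MetricGraph G hG} (h : ∀ w, x.coord w = y.coord w) : x = y :=
  Subtype.ext (funext h)

noncomputable instance : MetricSpace (MetricGraph G hG) where
  dist_self x := by
    refine le_antisymm ?_ (pathLengths_nonneg x x _ (dist_mem x x))
    rcases x.coord_cases with ⟨u, hu, -⟩ | ⟨u, v, huv, -, -, h1, -⟩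
    · exact dist_le_of_mem (Or.inl ⟨u, u, by linarith, by linarith, by simp [hu]⟩)
    · exact dist_le_of_mem (Or.inr ⟨u, v, huv, h1, h1, by simp⟩)
  dist_comm x y :=
    le_antisymm (dist_le_of_mem (mem_pathLengths_symm (dist_mem y x)))
      (dist_le_of_mem (mem_pathLengths_symm (dist_mem x y)))
  dist_triangle x y z := by
    obtain ⟨t, ht, h⟩ := exists_pathLengths_le (dist_mem x y) (dist_mem y z)
    exact (dist_le_of_mem ht).trans h
  eq_of_dist_eq_zero := by
    intro x y h
    have hm := dist_mem x y
    rw [h] at hm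
    rcases hm with ⟨u, v, hu, hv, h0⟩ | ⟨u, v, huv, hx, hy, h0⟩
    · have h1 := x.coord_le_one u
      have h2 := y.coord_le_one v
      have h3 : (0 : ℝ) ≤ G.dist u v := by positivity
      have h4 : G.dist u v = 0 := by
        have : (G.dist u v : ℝ) = 0 := by linarith
        exact_mod_cast this
      obtain rfl : u = v := hG.dist_eq_zero_iff.1 h4
      have hx1 : x.coord u = 1 := by linarith
      have hy1 : y.coord u = 1 := by linarith
      refine ext_coord fun w => ?_
      by_cases hw : w = u
      · rw [hw, hx1, hy1]
      · have aux : ∀ a : MetricGraph G hG, a.coord u = 1 → a.coord w = 0 := by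
          intro a ha
          by_contra hne
          have hpos := lt_of_le_of_ne (a.coord_nonneg w) (Ne.symm hne)
          have := (a.adj_of_coord_pos hpos (by linarith : 0 < a.coord u) hw).2
          linarith
        rw [aux x hx1, aux y hy1]
    · have h1 : x.coord u = y.coord u := sub_eq_zero.1 (abs_eq_zero.1 h0.symm)
      refine ext_coord fun w => ?_
      by_cases hwu : w = u
      · rw [hwu, h1]
      · by_cases hwv : w = v
        · rw [hwv]; linarith
        · rw [x.coord_eq_zero huv.ne hx hwu hwv, y.coord_eq_zero huv.ne hy hwu hwv]

end MetricGraph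

/-! ### Quasi-isometries -/

/-- A quasi-isometric embedding whose image is coarsely dense. -/
def IsQuasiIsometry {X Y : Type*} [MetricSpace X] [MetricSpace Y] (f : X → Y) : Prop :=
  (∃ l C : ℝ, 1 ≤ l ∧ 0 < C ∧ ∀ x x' : X,
    (1 / l) * dist x x' - C ≤ dist (f x) (f x') ∧ dist (f x) (f x') ≤ l * dist x x' + C) ∧
  ∃ D : ℝ, 0 < D ∧ ∀ y : Y, ∃ x : X, dist y (f x) ≤ D

def QuasiIsometric (X Y : Type*) [MetricSpace X] [MetricSpace Y] : Prop :=
  ∃ f : X → Y, IsQuasiIsometry f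

/-- The metric graph of `G` is quasi-isometric to a tree, that is, to the metric graph of a
connected acyclic graph. -/
def QuasiIsometricToTree.{u} {V : Type u} (G : SimpleGraph V) (hG : G.Connected) : Prop :=
  ∃ (W : Type u) (T : SimpleGraph W) (hT : T.IsTree),
    QuasiIsometric (MetricGraph G hG) (MetricGraph T hT.connected)

/-! ### Cycles, strict shortcuts and dense chordality -/

/-- The length metric `d_C` of a simple closed curve `C` of length `n`. Points of `C` are given by
their arc length parameters `s, t ∈ [0, n]`, where `0` and `n` are the same point. -/
def cycleDist (n : ℕ) (s t : ℝ) : ℝ := min |s - t| (n - |s - t|)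

/-- `σ` is a strict shortcut in the cycle `c`, joining the vertices of `c` with arc length
parameters `i` and `j`: it is a path shorter than their distance along `c`, and meets `c` only in
these two vertices. (A path that shares an edge with `c` and meets its vertices only in the two ends
is that edge, so it is not shorter than the distance along `c`.) -/
structure IsStrictShortcut {V : Type*} {G : SimpleGraph V} {u : V} (c : G.Walk u u) (i j : ℕ)
    (σ : G.Walk (c.getVert i) (c.getVert j)) : Prop where
  left_le : i ≤ c.length
  right_le : j ≤ c.length
  isPath : σ.IsPath
  length_lt : (σ.length : ℝ) < cycleDist c.length i j
  strict : ∀ w, w ∈ σ.support → w ∈ c.support → w = c.getVert i ∨ w = c.getVert j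

/-- The parameters of the shortcut vertices in `c` that are associated to the strict shortcuts of
length at most `m`. -/
def shortcutVertices {V : Type*} {G : SimpleGraph V} {u : V} (c : G.Walk u u) (m : ℕ) : Set ℕ :=
  {a | ∃ (i j : ℕ) (σ : G.Walk (c.getVert i) (c.getVert j)),
    IsStrictShortcut c i j σ ∧ σ.length ≤ m ∧ (a = i ∨ a = j)}

/-- `G` is `ε`-densely `(k, m)`-chordal: in every cycle `C` of length at least `k`, the shortcut
vertices associated to strict shortcuts of length at most `m` are `ε`-dense in `(C, d_C)`, where
all the points of `C` count, also those inside its edges. Only finitely many shortcuts are needed,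
because `C` has finitely many vertices. -/
def IsDenselyChordal {V : Type*} (G : SimpleGraph V) (ε : ℝ) (k m : ℕ) : Prop :=
  ∀ (u : V) (c : G.Walk u u), c.IsCycle → k ≤ c.length →
    ∀ s ∈ Set.Icc (0 : ℝ) c.length, ∃ a ∈ shortcutVertices c m, cycleDist c.length s a < ε

/-!
Both directions are reduced to the vertices: a metric graph is within distance one of its vertices,
on which its metric is the graph distance (`MetricGraph.dist_vertex`).

Suppose first that `G` is quasi-isometric to a tree. Then all walks between the ends of a geodesic
pass close to every vertex of the geodesic (`SimpleGraph.IsTree.exists_mem_support_dist_le`),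
because all three pass, up to a bounded error, through the median of the images in the tree. Let `p`
be a vertex of a long cycle `C`, and suppose that no short strict shortcut has an end near `p`. A
geodesic of `G` that joins vertices of `C` near `p` breaks up into pieces that meet `C` only in their
ends, and as none of them is a shortcut, it is no shorter than the arc of `C` between its ends
(`SimpleGraph.Walk.cycleDist_le_dist_of_lt`). So an arc of `C` centred at `p` is a geodesic, while
the complementary arc stays far from `p`, which contradicts the bottleneck property.

Conversely, fix a vertex `o`, and call two vertices equivalent if they are at the same distance `n`
from `o` and are joined by a walk outside the ball of radius `n - 1` around `o`. The classes, the
clusters, are the vertices of a tree in which every cluster has at most one neighbour closer to `o`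
(`SimpleGraph.layeringTree_isTree`). The projection of `G` to this tree is a quasi-isometry as soon
as the clusters have bounded diameter. If `G` is densely chordal, they do
(`SimpleGraph.dist_le_of_cluster_eq`): geodesics from `o` to two vertices of a cluster, cut off at
their last common vertex, and a path that joins the two vertices farther out form a cycle, and a
shortcut of this cycle that starts on one of the geodesics at a suitable bounded distance from its
end can only lead to the other geodesic. Hence the ends of the geodesics are close to each other.
-/

/-! ### Metric graphs and their vertices -/

namespace MetricGraph

variable {V : Type*} {G : SimpleGraph V} {hG : G.Connected}

open Classical in
/-- The vertex `v` as a point of the metric graph. -/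
noncomputable def vertex (hG : G.Connected) (v : V) : MetricGraph G hG :=
  ⟨Pi.single v 1, v, v, Or.inl rfl, left_mem_segment _ _ _⟩

theorem coord_vertex_self (v : V) : (vertex hG v).coord v = 1 := by
  simp [vertex, coord]

theorem coord_vertex_of_ne {v w : V} (h : w ≠ v) : (vertex hG v).coord w = 0 := by
  simp [vertex, coord, h]

theorem eq_of_coord_vertex_pos {v w : V} (h : 0 < (vertex hG v).coord w) : w = v := by
  by_contra hne
  simp [coord_vertex_of_ne hne] at h

theorem dist_vertex (u v : V) : dist (vertex hG u) (vertex hG v) = G.dist u v := by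
  refine le_antisymm (dist_le_of_mem (Or.inl ⟨u, v, ?_, ?_, ?_⟩)) ?_
  · simp [coord_vertex_self]
  · simp [coord_vertex_self]
  · simp [coord_vertex_self]
  · rcases dist_mem (vertex hG u) (vertex hG v) with ⟨a, b, ha, hb, h⟩ | ⟨a, b, hab, hu, hv, h⟩
    · obtain rfl := eq_of_coord_vertex_pos ha
      obtain rfl := eq_of_coord_vertex_pos hb
      simp [h, coord_vertex_self]
    · by_cases huv : u = v
      · simp [huv]
      · have hmem : ∀ w : V, (vertex hG w).coord a + (vertex hG w).coord b = 1 →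
            a = w ∨ b = w := by
          intro w hw
          by_contra! hne
          simp [coord_vertex_of_ne hne.1, coord_vertex_of_ne hne.2] at hw
        have hadj : G.Adj u v := by
          rcases hmem u hu with rfl | rfl <;> rcases hmem v hv with rfl | rfl
          · exact absurd rfl huv
          · exact hab
          · exact hab.symm
          · exact absurd rfl huv
        rw [SimpleGraph.dist_eq_one_iff_adj.2 hadj, h]
        rcases hmem u hu with rfl | rfl
        · simp [coord_vertex_self, coord_vertex_of_ne huv]
        · rcases hmem v hv with rfl | rfl
          · simp [coord_vertex_self, coord_vertex_of_ne hab.ne]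
          · exact absurd rfl huv

/-- An end of the edge on which `x` lies. -/
noncomputable def nearVertex (x : MetricGraph G hG) : V := x.exists_coord_pos.choose

theorem dist_nearVertex_le (x : MetricGraph G hG) : dist x (vertex hG x.nearVertex) ≤ 1 := by
  have hpos : 0 < x.coord x.nearVertex := x.exists_coord_pos.choose_spec
  refine (dist_le_of_mem (Or.inl ⟨x.nearVertex, x.nearVertex, hpos, ?_, rfl⟩)).trans ?_
  · simp [coord_vertex_self]
  · simp [coord_vertex_self, hpos.le]

theorem nearVertex_vertex (v : V) : (vertex hG v).nearVertex = v :=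
  eq_of_coord_vertex_pos (vertex hG v).exists_coord_pos.choose_spec

theorem abs_dist_sub_dist_nearVertex_le (x y : MetricGraph G hG) :
    |dist x y - G.dist x.nearVertex y.nearVertex| ≤ 2 := by
  rw [← dist_vertex (hG := hG)]
  have hx := x.dist_nearVertex_le
  have hy := y.dist_nearVertex_le
  have h1 := dist_triangle4 x (vertex hG x.nearVertex) (vertex hG y.nearVertex) y
  have h2 := dist_triangle4 (vertex hG x.nearVertex) x y (vertex hG y.nearVertex)
  rw [dist_comm (vertex hG y.nearVertex) y] at h1
  rw [dist_comm (vertex hG x.nearVertex) x] at h2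
  rw [abs_le]
  constructor <;> linarith

end MetricGraph

open MetricGraph

/-- A surjection between the vertex sets that is a quasi-isometry for the graph distances extends to
a quasi-isometry of the metric graphs. -/
theorem quasiIsometric_of_vertexMap {V W : Type*} {G : SimpleGraph V} {H : SimpleGraph W}
    (hG : G.Connected) (hH : H.Connected) (g : V → W) (hg : Function.Surjective g) (D : ℕ)
    (hle : ∀ u v, H.dist (g u) (g v) ≤ G.dist u v)
    (hge : ∀ u v, G.dist u v ≤ (D + 1) * H.dist (g u) (g v) + D) :
    QuasiIsometric (MetricGraph G hG) (MetricGraph H hH) := by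
  refine ⟨fun x => vertex hH (g x.nearVertex), ⟨D + 1, D + 2, by simp, by positivity, ?_⟩,
    1, one_pos, ?_⟩
  · intro x y
    rw [dist_vertex]
    have h1 := abs_le.1 (abs_dist_sub_dist_nearVertex_le x y)
    have h2 : (H.dist (g x.nearVertex) (g y.nearVertex) : ℝ) ≤
        G.dist x.nearVertex y.nearVertex := by exact_mod_cast hle _ _
    have h3 : (G.dist x.nearVertex y.nearVertex : ℝ) ≤
        (D + 1) * H.dist (g x.nearVertex) (g y.nearVertex) + D := by exact_mod_cast hge _ _
    have hD : (0 : ℝ) ≤ D := by positivity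
    have h0 : 0 ≤ dist x y := dist_nonneg
    constructor
    · rw [sub_le_iff_le_add, one_div_mul_eq_div, div_le_iff₀ (by positivity)]
      nlinarith
    · nlinarith
  · intro y
    obtain ⟨v, hv⟩ := hg y.nearVertex
    refine ⟨vertex hG v, ?_⟩
    simp only [nearVertex_vertex, hv]
    exact y.dist_nearVertex_le

/-- A quasi-isometry of metric graphs gives a map of their vertex sets that is coarsely Lipschitz
and coarsely injective at every scale. -/
theorem QuasiIsometric.exists_vertexMap {V W : Type*} {G : SimpleGraph V} {H : SimpleGraph W}
    {hG : G.Connected} {hH : H.Connected}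
    (h : QuasiIsometric (MetricGraph G hG) (MetricGraph H hH)) :
    ∃ (g : V → W) (K : ℕ), (∀ u v, G.Adj u v → H.dist (g u) (g v) ≤ K) ∧
      ∀ N : ℕ, ∃ E : ℕ, ∀ u v, H.dist (g u) (g v) ≤ N → G.dist u v ≤ E := by
  obtain ⟨f, ⟨l, C, hl, hC, hf⟩, -⟩ := h
  have hl0 : 0 < l := by linarith
  refine ⟨fun v => (f (vertex hG v)).nearVertex, ⌈l + C + 2⌉₊, ?_, fun N => ⟨⌈l * (N + C + 2)⌉₊, ?_⟩⟩
  · intro u v huv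
    have h1 := (hf (vertex hG u) (vertex hG v)).2
    have h2 := abs_le.1 (abs_dist_sub_dist_nearVertex_le (f (vertex hG u)) (f (vertex hG v)))
    rw [dist_vertex, SimpleGraph.dist_eq_one_iff_adj.2 huv] at h1
    have h3 := Nat.le_ceil (l + C + 2)
    push_cast at h1
    have : (H.dist (f (vertex hG u)).nearVertex (f (vertex hG v)).nearVertex : ℝ) ≤
        (⌈l + C + 2⌉₊ : ℝ) := by linarith
    exact_mod_cast this
  · intro u v huv
    have h1 := (hf (vertex hG u) (vertex hG v)).1
    have h2 := abs_le.1 (abs_dist_sub_dist_nearVertex_le (f (vertex hG u)) (f (vertex hG v)))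
    rw [dist_vertex] at h1
    have h3 := Nat.le_ceil (l * (N + C + 2))
    have h4 : (H.dist (f (vertex hG u)).nearVertex (f (vertex hG v)).nearVertex : ℝ) ≤ N := by
      exact_mod_cast huv
    have h5 : (G.dist u v : ℝ) / l ≤ N + C + 2 := by
      rw [one_div_mul_eq_div] at h1
      linarith
    rw [div_le_iff₀ hl0] at h5
    have : (G.dist u v : ℝ) ≤ (⌈l * (N + C + 2)⌉₊ : ℝ) := by linarith
    exact_mod_cast this

/-! ### Geodesics and the bottleneck property -/

namespace SimpleGraph

variable {V W : Type*} {G : SimpleGraph V} {T : SimpleGraph W}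

theorem Connected.exists_geodesic (hG : G.Connected) (x y : V) :
    ∃ p : G.Walk x y, p.IsPath ∧ p.length = G.dist x y ∧
      ∀ z ∈ p.support, G.dist x z + G.dist z y = G.dist x y := by
  classical
  obtain ⟨p, hp, hl⟩ := hG.exists_path_of_dist x y
  refine ⟨p, hp, hl, fun z hz => le_antisymm ?_ hG.dist_triangle⟩
  have h := congrArg Walk.length (p.take_spec hz)
  rw [Walk.length_append, hl] at h
  have h1 := dist_le (p.takeUntil z hz)
  have h2 := dist_le (p.dropUntil z hz)
  omega

theorem IsAcyclic.support_subset_of_isPath (hT : T.IsAcyclic) {a b : W} {p : T.Walk a b}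
    (hp : p.IsPath) (q : T.Walk a b) : p.support ⊆ q.support := by
  classical
  have h : p = q.bypass := congrArg Subtype.val ((hT.subsingleton_path a b).elim ⟨p, hp⟩ q.toPath)
  rw [h]
  exact q.support_bypass_subset_support

theorem Walk.IsPath.append_of_inter {a b c : V} {p : G.Walk a b} {q : G.Walk b c} (hp : p.IsPath)
    (hq : q.IsPath) (h : ∀ w ∈ p.support, w ∈ q.support → w = b) : (p.append q).IsPath := by
  rw [Walk.isPath_def, Walk.support_append, List.nodup_append']
  refine ⟨hp.support_nodup, hq.support_nodup.tail, fun w hw hw' => ?_⟩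
  obtain rfl := h w hw (List.mem_of_mem_tail hw')
  have := hq.support_nodup
  rw [← Walk.cons_tail_support, List.nodup_cons] at this
  exact this.1 hw'

/-- The median of three vertices of a tree lies on all walks between any two of them. -/
theorem IsTree.exists_median (hT : T.IsTree) (a b c : W) :
    ∃ t, (∀ q : T.Walk a b, t ∈ q.support) ∧ (∀ q : T.Walk a c, t ∈ q.support) ∧
      ∀ q : T.Walk c b, t ∈ q.support := by
  classical
  obtain ⟨p, hp, -⟩ := hT.connected.exists_path_of_dist a b
  -- the median is the vertex of the path from `a` to `b` that is closest to `c`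
  obtain ⟨t, ht, hmin⟩ := p.support.toFinset.exists_min_image (fun w => T.dist w c)
    ⟨a, by simp⟩
  simp only [List.mem_toFinset] at ht hmin
  obtain ⟨r, hr, -, hgeo⟩ := hT.connected.exists_geodesic t c
  have hmeet : ∀ w ∈ r.support, w ∈ p.support → w = t := by
    intro w hw hwp
    have h1 := hgeo w hw
    have h2 := hmin w hwp
    exact (hT.connected.dist_eq_zero_iff.1 (by omega)).symm
  have hpass : ∀ {d : W} (s : T.Walk d t), s.IsPath → s.support ⊆ p.support →
      ∀ q : T.Walk d c, t ∈ q.support := by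
    intro d s hs hsp q
    refine hT.isAcyclic.support_subset_of_isPath 
      (hs.append_of_inter hr fun w hw hw' => hmeet w hw' (hsp hw)) q ?_
    simp [Walk.mem_support_append_iff]
  refine ⟨t, fun q => hT.isAcyclic.support_subset_of_isPath hp q ht,
    hpass (p.takeUntil t ht) (hp.takeUntil ht) (p.support_takeUntil_subset_support ht), fun q => ?_⟩
  have h := hpass (p.dropUntil t ht).reverse (hp.dropUntil ht).reverse
    (by simpa using p.support_dropUntil_subset_support ht) q.reverse
  simpa using h

/-- The image of a walk under a coarsely Lipschitz map is filled in to a walk. -/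
theorem Walk.exists_walk_near_image {g : V → W} {K : ℕ} (hT : T.Connected)
    (hK : ∀ u v, G.Adj u v → T.dist (g u) (g v) ≤ K) {u v : V} (p : G.Walk u v) :
    ∃ q : T.Walk (g u) (g v), ∀ t ∈ q.support, ∃ x ∈ p.support, T.dist t (g x) ≤ K := by
  induction p with
  | nil => exact ⟨.nil, by simp⟩
  | @cons u w v h p ih =>
    obtain ⟨q, hq⟩ := ih
    obtain ⟨r, -, -, hr⟩ := hT.exists_geodesic (g u) (g w)
    refine ⟨r.append q, fun t ht => ?_⟩
    rcases (Walk.mem_support_append_iff _ _).1 ht with ht | ht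
    · refine ⟨u, by simp, ?_⟩
      have h1 := hr t ht
      have h2 := hK u w h
      rw [dist_comm]
      omega
    · obtain ⟨x, hx, hd⟩ := hq t ht
      exact ⟨x, by simp [hx], hd⟩

/-- The bottleneck property of graphs that map to a tree by a coarse embedding: all walks between
the ends of a geodesic pass close to every vertex of the geodesic. Both sides of the geodesic
and the walk come close to the median of the images of the three vertices. -/
theorem IsTree.exists_mem_support_dist_le (hG : G.Connected) (hT : T.IsTree) {g : V → W} {K E : ℕ}
    (hK : ∀ u v, G.Adj u v → T.dist (g u) (g v) ≤ K)
    (hE : ∀ u v, T.dist (g u) (g v) ≤ 2 * K → G.dist u v ≤ E) {x y p : V}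
    (hp : G.dist x p + G.dist p y = G.dist x y) (w : G.Walk x y) :
    ∃ z ∈ w.support, G.dist z p ≤ 2 * E := by
  obtain ⟨t, hxy, hxp, hpy⟩ := hT.exists_median (g x) (g y) (g p)
  have key : ∀ {u v : V} (r : G.Walk u v), (∀ q : T.Walk (g u) (g v), t ∈ q.support) →
      ∃ a ∈ r.support, T.dist t (g a) ≤ K := by
    intro u v r hq
    obtain ⟨q, hq'⟩ := r.exists_walk_near_image hT.connected hK
    exact hq' t (hq q)
  have hclose : ∀ {a b : V}, T.dist t (g a) ≤ K → T.dist t (g b) ≤ K → G.dist a b ≤ E := by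
    intro a b ha hb
    refine hE a b ?_
    have h : T.dist (g a) (g b) ≤ T.dist (g a) t + T.dist t (g b) := hT.connected.dist_triangle
    rw [dist_comm (u := g a) (v := t)] at h
    omega
  obtain ⟨r, -, -, hr⟩ := hG.exists_geodesic x p
  obtain ⟨s, -, -, hs⟩ := hG.exists_geodesic p y
  obtain ⟨a, ha, hta⟩ := key r hxp
  obtain ⟨b, hb, htb⟩ := key s hpy
  obtain ⟨z, hz, htz⟩ := key w hxy
  refine ⟨z, hz, ?_⟩
  have h1 := hr a ha
  have h2 := hs b hb
  have h3 := hclose hta htb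
  have h4 := hclose htz hta
  have h5 : G.dist x y ≤ G.dist x a + G.dist a y := hG.dist_triangle
  have h6 : G.dist a y ≤ G.dist a b + G.dist b y := hG.dist_triangle
  have h7 : G.dist z p ≤ G.dist z a + G.dist a p := hG.dist_triangle
  omega

end SimpleGraph

/-! ### Geodesics on cycles without short shortcuts -/

theorem cycleDist_comm (n : ℕ) (s t : ℝ) : cycleDist n s t = cycleDist n t s := by
  simp [cycleDist, abs_sub_comm]

theorem cycleDist_self (n : ℕ) (s : ℝ) : cycleDist n s s = 0 := by
  simp [cycleDist]

theorem cycleDist_nonneg {n : ℕ} {s t : ℝ} (hs : s ∈ Set.Icc (0 : ℝ) n)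
    (ht : t ∈ Set.Icc (0 : ℝ) n) : 0 ≤ cycleDist n s t := by
  obtain ⟨hs0, hsn⟩ := hs
  obtain ⟨ht0, htn⟩ := ht
  exact le_min (abs_nonneg _) (sub_nonneg.2 (abs_le.2 ⟨by linarith, by linarith⟩))

theorem cycleDist_le_abs (n : ℕ) (s t : ℝ) : cycleDist n s t ≤ |s - t| := min_le_left _ _

theorem cycleDist_triangle {n : ℕ} {r s t : ℝ} (hr : r ∈ Set.Icc (0 : ℝ) n)
    (hs : s ∈ Set.Icc (0 : ℝ) n) (ht : t ∈ Set.Icc (0 : ℝ) n) :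
    cycleDist n r t ≤ cycleDist n r s + cycleDist n s t := by
  obtain ⟨hr0, hrn⟩ := hr
  obtain ⟨hs0, hsn⟩ := hs
  obtain ⟨ht0, htn⟩ := ht
  unfold cycleDist
  have h1 := abs_cases (r - s)
  have h2 := abs_cases (s - t)
  have h3 := abs_cases (r - t)
  have h4 := min_cases |r - s| (n - |r - s|)
  have h5 := min_cases |s - t| (n - |s - t|)
  have h6 := min_le_left |r - t| (n - |r - t|)
  have h7 := min_le_right |r - t| (n - |r - t|)
  grind

theorem natCast_mem_Icc {i n : ℕ} (h : i ≤ n) : (i : ℝ) ∈ Set.Icc (0 : ℝ) n :=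
  ⟨by positivity, by exact_mod_cast h⟩

namespace SimpleGraph

variable {V W : Type*} {G : SimpleGraph V} {T : SimpleGraph W} {u v : V}

theorem Walk.exists_segment (p : G.Walk u v) {a b : ℕ} (hab : a ≤ b) (hb : b ≤ p.length) :
    ∃ q : G.Walk (p.getVert a) (p.getVert b), q.length = b - a ∧
      ∀ z ∈ q.support, ∃ l, a ≤ l ∧ l ≤ b ∧ z = p.getVert l := by
  induction b, hab using Nat.le_induction with
  | base => exact ⟨.nil, by simp, by simpa using ⟨a, le_rfl, le_rfl, rfl⟩⟩
  | succ b hab ih =>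
    obtain ⟨q, hq, hs⟩ := ih (by omega)
    refine ⟨q.concat (p.adj_getVert_succ (by omega)), by rw [Walk.length_concat]; omega,
      fun z hz => ?_⟩
    rw [Walk.support_concat, List.mem_append, List.mem_singleton] at hz
    rcases hz with hz | rfl
    · obtain ⟨l, h1, h2, h3⟩ := hs z hz
      exact ⟨l, h1, by omega, h3⟩
    · exact ⟨b + 1, by omega, le_rfl, rfl⟩

theorem Walk.dist_getVert_le_cycleDist (hG : G.Connected) (c : G.Walk u u) {i j : ℕ}
    (hi : i ≤ c.length) (hj : j ≤ c.length) :
    (G.dist (c.getVert i) (c.getVert j) : ℝ) ≤ cycleDist c.length i j := by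
  wlog hij : i ≤ j generalizing i j
  · rw [dist_comm, cycleDist_comm]
    exact this hj hi (by omega)
  have hij' : (i : ℝ) ≤ j := by exact_mod_cast hij
  have habs : |(i : ℝ) - j| = j - i := by
    rw [abs_of_nonpos (by linarith)]
    ring
  rw [cycleDist, habs]
  refine le_min ?_ ?_
  · obtain ⟨q, hq, -⟩ := c.exists_segment hij hj
    have h := dist_le q
    rw [hq] at h
    rw [← Nat.cast_sub hij]
    exact_mod_cast h
  · obtain ⟨q, hq, -⟩ := c.exists_segment (Nat.zero_le i) hi
    obtain ⟨r, hr, -⟩ := c.exists_segment hj le_rfl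
    have h1 := dist_le q
    have h2 := dist_le r
    rw [hq, c.getVert_zero, dist_comm] at h1
    rw [hr, c.getVert_length, dist_comm] at h2
    have h3 : G.dist (c.getVert i) (c.getVert j) ≤
        G.dist (c.getVert i) u + G.dist u (c.getVert j) := hG.dist_triangle
    have h4 : (G.dist (c.getVert i) (c.getVert j) : ℝ) + j ≤ i + c.length := by
      exact_mod_cast (by omega :
        G.dist (c.getVert i) (c.getVert j) + j ≤ i + c.length)
    linarith

/-- Around a vertex `p` that is far from the shortcut vertices, the closed walk `c` is embedded
isometrically: a geodesic between two of its vertices breaks up into pieces that meet `c` only in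
their ends, and none of them is a shortcut. -/
theorem Walk.cycleDist_le_dist_of_lt (hG : G.Connected) (c : G.Walk u u) {m p : ℕ}
    (hp : p ≤ c.length) (hfar : ∀ a ∈ shortcutVertices c m, (m : ℝ) < cycleDist c.length p a)
    {i j : ℕ} (hi : i ≤ c.length) (hj : j ≤ c.length)
    (hm : cycleDist c.length p i + G.dist (c.getVert i) (c.getVert j) ≤ m) :
    cycleDist c.length i j ≤ G.dist (c.getVert i) (c.getVert j) := by
  induction hd : G.dist (c.getVert i) (c.getVert j) using Nat.strong_induction_on
    generalizing i j with
  | _ d ih =>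
  by_contra! hlt
  obtain ⟨σ, hσ, hl, hgeo⟩ := hG.exists_geodesic (c.getVert i) (c.getVert j)
  have hp0 := cycleDist_nonneg (natCast_mem_Icc hp) (natCast_mem_Icc hi)
  by_cases hstrict : ∀ w, w ∈ σ.support → w ∈ c.support → w = c.getVert i ∨ w = c.getVert j
  · have hmem : i ∈ shortcutVertices c m := by
      refine ⟨i, j, σ, ⟨hi, hj, hσ, by rwa [hl, hd], hstrict⟩, ?_, Or.inl rfl⟩
      have : (σ.length : ℝ) ≤ m := by rw [hl]; linarith
      exact_mod_cast this
    have h1 := hfar i hmem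
    have h2 : (0 : ℝ) ≤ G.dist (c.getVert i) (c.getVert j) := by positivity
    linarith
  · push Not at hstrict
    obtain ⟨w, hw, hwc, hwi, hwj⟩ := hstrict
    obtain ⟨l, rfl, hlc⟩ := Walk.mem_support_iff_exists_getVert.1 hwc
    have hsum := hgeo _ hw
    have h1 := hG.pos_dist_of_ne hwi.symm
    have h2 := hG.pos_dist_of_ne hwj
    have hsum' : (G.dist (c.getVert i) (c.getVert l) : ℝ) + G.dist (c.getVert l) (c.getVert j) =
      G.dist (c.getVert i) (c.getVert j) := by exact_mod_cast hsum
    have h0 : (0 : ℝ) ≤ G.dist (c.getVert l) (c.getVert j) := by positivity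
    have h3 := ih _ (by omega) hi hlc (by linarith) rfl
    have h4 := cycleDist_triangle (natCast_mem_Icc hp) (natCast_mem_Icc hi) (natCast_mem_Icc hlc)
    have h5 := ih _ (by omega) hlc hj (by linarith) rfl
    have h6 := cycleDist_triangle (natCast_mem_Icc hi) (natCast_mem_Icc hlc) (natCast_mem_Icc hj)
    rw [← hd] at hlt
    linarith

/-- The arc of a closed walk that is complementary to the arc of radius `h` around the vertex with
parameter `p`. -/
theorem Walk.exists_complementary_arc (c : G.Walk u u) {p h : ℕ} (hp : p ≤ c.length)
    (hc : 4 * h ≤ c.length) :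
    ∃ x y, x ≤ c.length ∧ y ≤ c.length ∧ cycleDist c.length p x = h ∧
      cycleDist c.length p y = h ∧ cycleDist c.length x y = 2 * h ∧
      ∃ q : G.Walk (c.getVert x) (c.getVert y), ∀ z ∈ q.support, ∃ l, l ≤ c.length ∧
        z = c.getVert l ∧ (h : ℝ) ≤ cycleDist c.length p l := by
  have hcR : (4 : ℝ) * h ≤ c.length := by exact_mod_cast hc
  have hpR : (p : ℝ) ≤ c.length := by exact_mod_cast hp
  have hp0 : (0 : ℝ) ≤ p := by positivity
  have hh0 : (0 : ℝ) ≤ h := by positivity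
  have hdist : ∀ {a b t : ℝ}, |a - b| = t ∨ |a - b| = c.length - t → 2 * t ≤ c.length →
      cycleDist c.length a b = t := by
    intro a b t ht h2
    unfold cycleDist
    rcases ht with ht | ht <;> rw [ht]
    · exact min_eq_left (by linarith)
    · rw [min_eq_right (by linarith)]
      ring
  by_cases h1 : p < h
  · have h1' : (p : ℝ) < h := by exact_mod_cast h1
    obtain ⟨q, -, hq⟩ := c.exists_segment (a := p + h) (b := p + c.length - h) (by omega) (by omega)
    have hcast : ((p + c.length - h : ℕ) : ℝ) = p + c.length - h := by
      rw [Nat.cast_sub (by omega)]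
      push_cast
      ring
    refine ⟨p + h, p + c.length - h, by omega, by omega, hdist ?_ (by linarith),
      hdist ?_ (by linarith), hdist ?_ (by linarith), q, fun z hz => ?_⟩
    · left; push_cast; rw [abs_of_nonpos] <;> linarith
    · right; rw [hcast, abs_of_nonpos] <;> linarith
    · right; rw [hcast]; push_cast; rw [abs_of_nonpos] <;> linarith
    · obtain ⟨l, hl1, hl2, rfl⟩ := hq z hz
      refine ⟨l, by omega, rfl, ?_⟩
      have e1 : (p : ℝ) + h ≤ l := by exact_mod_cast hl1
      have e2 : (l : ℝ) ≤ p + c.length - h := by rw [← hcast]; exact_mod_cast hl2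
      rw [cycleDist, abs_of_nonpos (by linarith)]
      exact le_min (by linarith) (by linarith)
  by_cases h2 : p + h ≤ c.length
  · have h1' : (h : ℝ) ≤ p := by exact_mod_cast not_lt.1 h1
    have h2' : (p : ℝ) + h ≤ c.length := by exact_mod_cast h2
    obtain ⟨q, -, hq⟩ := c.exists_segment (a := 0) (b := p - h) (by omega) (by omega)
    obtain ⟨r, -, hr⟩ := c.exists_segment (a := p + h) (b := c.length) (by omega) le_rfl
    have hcast : ((p - h : ℕ) : ℝ) = p - h := Nat.cast_sub (not_lt.1 h1)
    refine ⟨p - h, p + h, by omega, by omega, hdist ?_ (by linarith),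
      hdist ?_ (by linarith), hdist ?_ (by linarith),
      q.reverse.append ((r.copy rfl (by simp)).reverse), fun z hz => ?_⟩
    · left; rw [hcast, abs_of_nonneg] <;> linarith
    · left; push_cast; rw [abs_of_nonpos] <;> linarith
    · left; rw [hcast]; push_cast; rw [abs_of_nonpos] <;> linarith
    · simp only [Walk.mem_support_append_iff, Walk.support_reverse, List.mem_reverse,
        Walk.support_copy] at hz
      rcases hz with hz | hz
      · obtain ⟨l, hl1, hl2, rfl⟩ := hq z hz
        refine ⟨l, by omega, rfl, ?_⟩
        have e2 : (l : ℝ) ≤ p - h := by rw [← hcast]; exact_mod_cast hl2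
        have e3 : (0 : ℝ) ≤ l := by positivity
        rw [cycleDist, abs_of_nonneg (by linarith)]
        exact le_min (by linarith) (by linarith)
      · obtain ⟨l, hl1, hl2, rfl⟩ := hr z hz
        refine ⟨l, by omega, rfl, ?_⟩
        have e1 : (p : ℝ) + h ≤ l := by exact_mod_cast hl1
        have e2 : (l : ℝ) ≤ c.length := by exact_mod_cast hl2
        rw [cycleDist, abs_of_nonpos (by linarith)]
        exact le_min (by linarith) (by linarith)
  · have h1' : (h : ℝ) ≤ p := by exact_mod_cast not_lt.1 h1
    have h2' : (c.length : ℝ) < p + h := by exact_mod_cast not_le.1 h2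
    obtain ⟨q, -, hq⟩ := c.exists_segment (a := p + h - c.length) (b := p - h) (by omega) (by omega)
    have hcast : ((p - h : ℕ) : ℝ) = p - h := Nat.cast_sub (not_lt.1 h1)
    have hcast' : ((p + h - c.length : ℕ) : ℝ) = p + h - c.length := by
      rw [Nat.cast_sub (by omega)]
      push_cast
      ring
    refine ⟨p + h - c.length, p - h, by omega, by omega, hdist ?_ (by linarith),
      hdist ?_ (by linarith), hdist ?_ (by linarith), q, fun z hz => ?_⟩
    · right; rw [hcast', abs_of_nonneg] <;> linarith
    · left; rw [hcast, abs_of_nonneg] <;> linarith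
    · right; rw [hcast, hcast', abs_of_nonpos] <;> linarith
    · obtain ⟨l, hl1, hl2, rfl⟩ := hq z hz
      refine ⟨l, by omega, rfl, ?_⟩
      have e1 : (p : ℝ) + h - c.length ≤ l := by rw [← hcast']; exact_mod_cast hl1
      have e2 : (l : ℝ) ≤ p - h := by rw [← hcast]; exact_mod_cast hl2
      rw [cycleDist, abs_of_nonneg (by linarith)]
      exact le_min (by linarith) (by linarith)

/-- If a graph maps to a tree by a coarse embedding, then every vertex of a long closed walk is close
to a shortcut vertex. Otherwise the walk contains a geodesic of length `2 * h` around that vertex,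
and the complementary arc would be a way around the bottleneck. -/
theorem IsTree.exists_shortcutVertex_near (hG : G.Connected) (hT : T.IsTree) {g : V → W} {K E h : ℕ}
    (hK : ∀ u v, G.Adj u v → T.dist (g u) (g v) ≤ K)
    (hE : ∀ u v, T.dist (g u) (g v) ≤ 2 * K → G.dist u v ≤ E) (hh : 2 * E < h)
    (c : G.Walk u u) (hc : 4 * h ≤ c.length) {p : ℕ} (hp : p ≤ c.length) :
    ∃ a ∈ shortcutVertices c (2 * h), a ≤ c.length ∧ cycleDist c.length p a ≤ 3 * h := by
  have hle : ∀ a ∈ shortcutVertices c (2 * h), a ≤ c.length := by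
    rintro a ⟨i, j, σ, hσ, -, rfl | rfl⟩
    exacts [hσ.left_le, hσ.right_le]
  by_contra! hfar
  obtain ⟨x, y, hx, hy, hpx, hpy, hxy, q, hq⟩ := c.exists_complementary_arc hp hc
  have hfar' : ∀ a ∈ shortcutVertices c (2 * h), (3 : ℝ) * h < cycleDist c.length p a :=
    fun a ha => hfar a ha (hle a ha)
  have hh0 : (0 : ℝ) ≤ h := by positivity
  have hgeo : ((2 * h : ℕ) : ℝ) ≤ G.dist (c.getVert x) (c.getVert y) := by
    have h1 := c.dist_getVert_le_cycleDist hG hx hy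
    push_cast
    rw [← hxy]
    refine c.cycleDist_le_dist_of_lt hG hx (m := 2 * h) (fun a ha => ?_) hx hy ?_
    · have h2 := cycleDist_triangle (natCast_mem_Icc hp) (natCast_mem_Icc hx)
        (natCast_mem_Icc (hle a ha))
      have h3 := hfar' a ha
      push_cast
      linarith
    · rw [cycleDist_self]
      push_cast
      linarith
  have hxp : G.dist (c.getVert x) (c.getVert p) ≤ h := by
    have h1 := c.dist_getVert_le_cycleDist hG hp hx
    rw [hpx, dist_comm] at h1
    exact_mod_cast h1
  have hpy' : G.dist (c.getVert p) (c.getVert y) ≤ h := by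
    have h1 := c.dist_getVert_le_cycleDist hG hp hy
    rw [hpy] at h1
    exact_mod_cast h1
  have htri : G.dist (c.getVert x) (c.getVert y) ≤
      G.dist (c.getVert x) (c.getVert p) + G.dist (c.getVert p) (c.getVert y) := hG.dist_triangle
  have hgeo' : 2 * h ≤ G.dist (c.getVert x) (c.getVert y) := by exact_mod_cast hgeo
  obtain ⟨z, hz, hzp⟩ := hT.exists_mem_support_dist_le hG hK hE
    (p := c.getVert p) (by omega) q
  obtain ⟨l, hl, rfl, hpl⟩ := hq z hz
  rw [dist_comm] at hzp
  have hzp' : (G.dist (c.getVert p) (c.getVert l) : ℝ) < h := by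
    exact_mod_cast (by omega : G.dist (c.getVert p) (c.getVert l) < h)
  have h1 := c.cycleDist_le_dist_of_lt hG hp (m := 2 * h) (fun a ha => ?_) hp hl ?_
  · linarith
  · have := hfar' a ha
    push_cast
    linarith
  · rw [cycleDist_self]
    push_cast
    linarith

end SimpleGraph

theorem QuasiIsometricToTree.exists_isDenselyChordal {V : Type*} {G : SimpleGraph V}
    {hG : G.Connected} (h : QuasiIsometricToTree G hG) :
    ∃ (ε : ℝ) (k m : ℕ), 0 < ε ∧ 4 ≤ k ∧ 2 * m ≤ k ∧ IsDenselyChordal G ε k m := by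
  obtain ⟨W, T, hT, hqi⟩ := h
  obtain ⟨g, K, hK, hE⟩ := hqi.exists_vertexMap
  obtain ⟨E, hE⟩ := hE (2 * K)
  -- with `h = 2 * E + 1`, every vertex of a cycle of length at least `4 * h` is within `3 * h` of an
  -- end of a shortcut of length at most `2 * h`; the points inside the edges cost the summand `1`
  refine ⟨3 * (2 * E + 1 : ℕ) + 1, 4 * (2 * E + 1), 2 * (2 * E + 1), by positivity, by omega,
    by omega, fun u c _ hc s hs => ?_⟩
  -- a point inside an edge is at distance less than one from a vertex
  have hp : ⌊s⌋₊ ≤ c.length := Nat.floor_le_of_le hs.2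
  obtain ⟨a, ha, hac, hd⟩ := hT.exists_shortcutVertex_near hG hK hE (Nat.lt_succ_self _) c hc hp
  refine ⟨a, ha, ?_⟩
  have h1 := cycleDist_triangle hs (natCast_mem_Icc hp) (natCast_mem_Icc hac)
  have h2 := cycleDist_le_abs c.length s ⌊s⌋₊
  have h3 := Nat.floor_le hs.1
  have h4 := Nat.lt_floor_add_one s
  rw [abs_of_nonneg (by linarith)] at h2
  simp only [Nat.succ_eq_add_one] at hd
  linarith

/-! ### The layering tree -/

namespace SimpleGraph

variable {V W : Type*} {G : SimpleGraph V} {T : SimpleGraph W}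

/-- A graph is acyclic if adjacent vertices have different levels and every vertex has at most one
neighbour of lower level: the highest vertex of a cycle would have two of them. -/
theorem isAcyclic_of_level (l : W → ℕ) (hne : ∀ a b, T.Adj a b → l a ≠ l b)
    (huniq : ∀ a b c, T.Adj a b → T.Adj a c → l b < l a → l c < l a → b = c) : T.IsAcyclic := by
  classical
  intro v c hc
  obtain ⟨w, hw, hmax⟩ := c.support.toFinset.exists_max_image l ⟨v, by simp⟩
  simp only [List.mem_toFinset] at hw hmax
  have hr : (c.rotate w hw).IsCycle := hc.rotate hw
  have hmem : ∀ x, x ∈ (c.rotate w hw).support → l x ≤ l w := fun x hx =>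
    hmax x ((Walk.mem_support_rotate_iff ..).1 hx)
  have h1 := (c.rotate w hw).adj_snd hr.not_nil
  have h2 := ((c.rotate w hw).adj_penultimate hr.not_nil).symm
  exact hr.snd_ne_penultimate (huniq w _ _ h1 h2
    (lt_of_le_of_ne (hmem _ (Walk.getVert_mem_support _ _)) (hne _ _ h1).symm)
    (lt_of_le_of_ne (hmem _ (Walk.getVert_mem_support _ _)) (hne _ _ h2).symm))

variable (G) (o : V)

/-- Two vertices are in the same cluster if they are at the same distance from the base vertex `o`
and are joined by a walk that does not come closer to `o`. -/
def clusterSetoid : Setoid V where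
  r u v := G.dist o u = G.dist o v ∧ ∃ p : G.Walk u v, ∀ w ∈ p.support, G.dist o u ≤ G.dist o w
  iseqv :=
    { refl := fun _ => ⟨rfl, .nil, by simp⟩
      symm := fun ⟨h, p, hp⟩ => ⟨h.symm, p.reverse, by simpa [← h] using hp⟩
      trans := by
        rintro u v w ⟨h, p, hp⟩ ⟨h', q, hq⟩
        refine ⟨h.trans h', p.append q, fun x hx => ?_⟩
        rcases (Walk.mem_support_append_iff _ _).1 hx with hx | hx
        exacts [hp x hx, h ▸ hq x hx] }

/-- The vertices of the layering tree. -/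
abbrev Cluster : Type _ := Quotient (clusterSetoid G o)

/-- The cluster of a vertex. -/
def cluster (v : V) : Cluster G o := Quotient.mk _ v

/-- The graph of clusters: two clusters are adjacent if an edge of `G` joins them. -/
def layeringTree : SimpleGraph (Cluster G o) where
  Adj A B := A ≠ B ∧ ∃ u v, cluster G o u = A ∧ cluster G o v = B ∧ G.Adj u v
  symm := ⟨fun _ _ ⟨h, u, v, hu, hv, huv⟩ => ⟨h.symm, v, u, hv, hu, huv.symm⟩⟩
  loopless := ⟨fun _ h => h.1 rfl⟩

variable {G o}

theorem cluster_eq_iff {u v : V} : cluster G o u = cluster G o v ↔ G.dist o u = G.dist o v ∧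
    ∃ p : G.Walk u v, ∀ w ∈ p.support, G.dist o u ≤ G.dist o w :=
  Quotient.eq

theorem cluster_eq_of_adj {u v : V} (huv : G.Adj u v) (h : G.dist o u = G.dist o v) :
    cluster G o u = cluster G o v :=
  cluster_eq_iff.2 ⟨h, huv.toWalk, by simp [h]⟩

variable (G o) in
/-- The distance of the vertices of a cluster from the base vertex. -/
noncomputable def Cluster.level : Cluster G o → ℕ := Quotient.lift (G.dist o) fun _ _ h => h.1

theorem level_cluster (v : V) : Cluster.level G o (cluster G o v) = G.dist o v := rfl

theorem exists_layeringTree_walk {u v : V} (p : G.Walk u v) :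
    ∃ q : (layeringTree G o).Walk (cluster G o u) (cluster G o v), q.length ≤ p.length := by
  induction p with
  | nil => exact ⟨.nil, le_rfl⟩
  | @cons u w v h p ih =>
    obtain ⟨q, hq⟩ := ih
    by_cases he : cluster G o u = cluster G o w
    · exact ⟨q.copy he.symm rfl, by simp only [Walk.length_copy, Walk.length_cons]; omega⟩
    · have hadj : (layeringTree G o).Adj (cluster G o u) (cluster G o w) :=
        ⟨he, u, w, rfl, rfl, h⟩
      exact ⟨.cons hadj q, by simp only [Walk.length_cons]; omega⟩

theorem dist_cluster_le (hG : G.Connected) (u v : V) :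
    (layeringTree G o).dist (cluster G o u) (cluster G o v) ≤ G.dist u v := by
  obtain ⟨p, hp⟩ := hG.exists_walk_length_eq_dist u v
  obtain ⟨q, hq⟩ := exists_layeringTree_walk (o := o) p
  exact (dist_le q).trans (hp ▸ hq)

theorem layeringTree_isTree (hG : G.Connected) : (layeringTree G o).IsTree := by
  have hstep : ∀ {u v : V}, G.Adj u v → G.dist o u ≤ G.dist o v + 1 := by
    intro u v huv
    have h : G.dist o u ≤ G.dist o v + G.dist v u := hG.dist_triangle
    rwa [dist_eq_one_iff_adj.2 huv.symm] at h
  have : Nonempty (Cluster G o) := ⟨cluster G o o⟩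
  refine ⟨⟨?_⟩, isAcyclic_of_level (Cluster.level G o) ?_ ?_⟩
  · rintro ⟨u⟩ ⟨v⟩
    obtain ⟨p⟩ := hG.preconnected u v
    exact ⟨(exists_layeringTree_walk p).choose⟩
  · rintro _ _ ⟨hne, u, v, rfl, rfl, huv⟩ h
    exact hne (cluster_eq_of_adj huv h)
  · rintro A _ _ ⟨-, u, v, hu, rfl, huv⟩ ⟨-, u', v', hu', rfl, huv'⟩ hl hl'
    -- the lower neighbours `v` and `v'` are joined through the cluster of `u` and `u'`
    subst hu
    obtain ⟨he, p, hp⟩ := cluster_eq_iff.1 hu'.symm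
    simp only [level_cluster] at hl hl'
    have h1 := hstep huv
    have h2 := hstep huv'
    refine cluster_eq_iff.2 ⟨by omega, (Walk.cons huv.symm p).concat huv', fun w hw => ?_⟩
    rw [Walk.support_concat, List.mem_append, List.mem_singleton,
      Walk.support_cons, List.mem_cons] at hw
    rcases hw with (rfl | hw) | rfl
    · exact le_rfl
    · have := hp w hw
      omega
    · omega

theorem dist_le_of_cluster_dist_le (hG : G.Connected) {D : ℕ}
    (hD : ∀ u v, cluster G o u = cluster G o v → G.dist u v ≤ D) (u v : V) :
    G.dist u v ≤ (D + 1) * (layeringTree G o).dist (cluster G o u) (cluster G o v) + D := by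
  have key : ∀ {A B : Cluster G o} (q : (layeringTree G o).Walk A B) (u v : V),
      cluster G o u = A → cluster G o v = B → G.dist u v ≤ (D + 1) * q.length + D := by
    intro A B q
    induction q with
    | nil =>
      intro u v hu hv
      simpa using hD u v (hu.trans hv.symm)
    | cons h q ih =>
      intro u v hu hv
      obtain ⟨-, u', w, hu', hw, hadj⟩ := id h
      have h1 := hD u u' (hu.trans hu'.symm)
      have h2 := ih w v hw hv
      have h3 := dist_eq_one_iff_adj.2 hadj
      have h4 : G.dist u v ≤ G.dist u u' + G.dist u' v := hG.dist_triangle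
      have h5 : G.dist u' v ≤ G.dist u' w + G.dist w v := hG.dist_triangle
      rw [Walk.length_cons, mul_add, mul_one]
      omega
  obtain ⟨q, hq⟩ := (layeringTree_isTree hG).connected.exists_walk_length_eq_dist
    (cluster G o u) (cluster G o v)
  exact hq ▸ key q u v rfl rfl

end SimpleGraph

/-! ### Clusters of densely chordal graphs -/

theorem exists_of_mem_shortcutVertices {V : Type*} {G : SimpleGraph V} {u : V} {c : G.Walk u u}
    {m a : ℕ} (ha : a ∈ shortcutVertices c m) :
    a ≤ c.length ∧ ∃ b, b ≤ c.length ∧ G.dist (c.getVert a) (c.getVert b) ≤ m ∧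
      (G.dist (c.getVert a) (c.getVert b) : ℝ) < cycleDist c.length a b := by
  obtain ⟨i, j, σ, hσ, hm, h⟩ := ha
  have hd := SimpleGraph.dist_le σ
  have hlt : (G.dist (c.getVert i) (c.getVert j) : ℝ) < cycleDist c.length i j :=
    lt_of_le_of_lt (by exact_mod_cast hd) hσ.length_lt
  rcases h with rfl | rfl
  · exact ⟨hσ.left_le, j, hσ.right_le, hd.trans hm, hlt⟩
  · rw [SimpleGraph.dist_comm, cycleDist_comm] at hlt
    exact ⟨hσ.right_le, i, hσ.left_le, by rw [SimpleGraph.dist_comm]; exact hd.trans hm, hlt⟩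

namespace SimpleGraph

variable {V : Type*} {G : SimpleGraph V}

theorem Walk.dist_getVert_of_length_eq_dist (hG : G.Connected) {x y : V} {p : G.Walk x y}
    (hp : p.length = G.dist x y) {i : ℕ} (hi : i ≤ p.length) :
    G.dist x (p.getVert i) = i ∧ G.dist (p.getVert i) y = p.length - i := by
  obtain ⟨q, hq, -⟩ := p.exists_segment (Nat.zero_le i) hi
  obtain ⟨r, hr, -⟩ := p.exists_segment hi le_rfl
  have h1 := dist_le q
  have h2 := dist_le r
  rw [hq, p.getVert_zero] at h1
  rw [hr, p.getVert_length] at h2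
  have h3 : G.dist x y ≤ G.dist x (p.getVert i) + G.dist (p.getVert i) y := hG.dist_triangle
  omega

/-- The last vertex that lies both on a geodesic from `o` to `u` and on one from `o` to `v`. -/
theorem exists_branch_vertex (o u v : V) :
    ∃ z, G.dist o z + G.dist z u = G.dist o u ∧ G.dist o z + G.dist z v = G.dist o v ∧
      ∀ w, G.dist o w + G.dist w u = G.dist o u → G.dist o w + G.dist w v = G.dist o v →
        G.dist o w ≤ G.dist o z := by
  let S : Set ℕ := {n | ∃ w, (G.dist o w + G.dist w u = G.dist o u ∧
    G.dist o w + G.dist w v = G.dist o v) ∧ G.dist o w = n}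
  have hne : S.Nonempty := ⟨0, o, by simp, by simp⟩
  have hbdd : BddAbove S := ⟨G.dist o u, by rintro _ ⟨w, ⟨hw, -⟩, rfl⟩; omega⟩
  obtain ⟨z, ⟨hu, hv⟩, hz⟩ := Nat.sSup_mem hne hbdd
  exact ⟨z, hu, hv, fun w hwu hwv => hz ▸ le_csSup hbdd ⟨w, ⟨hwu, hwv⟩, rfl⟩⟩

/-- The clusters of a densely chordal graph have bounded diameter. Two geodesics from the base
vertex to vertices `u`, `v` of a cluster, together with a path between `u` and `v` that does not come
closer to the base vertex, form a cycle. Consider a shortcut that starts on the first geodesic,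
well below `u`. It cannot end on this geodesic, and it is too short to reach the path. So it
leads to the second geodesic, and hence `u` and `v` are close to each other. -/
theorem dist_le_of_cluster_eq (hG : G.Connected) {ε : ℝ} {k m : ℕ} (h : IsDenselyChordal G ε k m)
    {o u v : V} (huv : cluster G o u = cluster G o v) :
    G.dist u v ≤ 2 * (2 * m + 2 * ⌈ε⌉₊ + k + 2) := by
  classical
  obtain ⟨hl, r, hr⟩ := cluster_eq_iff.1 huv
  obtain ⟨z, hzu, hzv, hmax⟩ := G.exists_branch_vertex o u v
  obtain ⟨P, hP, hPl, hPg⟩ := hG.exists_geodesic z u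
  obtain ⟨Q, hQ, hQl, hQg⟩ := hG.exists_geodesic z v
  set t := P.length with ht
  set e := ⌈ε⌉₊
  have htri : ∀ a b c : V, G.dist a c ≤ G.dist a b + G.dist b c := fun a b c => hG.dist_triangle
  -- if the legs below `u` and `v` are short, then they give a short walk through `z`
  by_cases hsmall : t < m + 2 * e + k + 2
  · have h1 := htri u z v
    rw [dist_comm (u := u) (v := z)] at h1
    omega
  have hR : r.bypass.IsPath := r.bypass_isPath
  have hRl : ∀ w ∈ r.bypass.support, G.dist o u ≤ G.dist o w :=
    fun w hw => hr w (r.support_bypass_subset_support hw)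
  have hPo : ∀ w ∈ P.support, G.dist o w = G.dist o z + G.dist z w := by
    intro w hw
    have h1 := hPg w hw
    have h2 := htri o z w
    have h3 := htri o w u
    omega
  have hQo : ∀ w ∈ Q.support, G.dist o w = G.dist o z + G.dist z w := by
    intro w hw
    have h1 := hQg w hw
    have h2 := htri o z w
    have h3 := htri o w v
    omega
  have hRQ : (r.bypass.append Q.reverse).IsPath := by
    refine hR.append_of_inter hQ.reverse fun w hw hw' => ?_
    rw [Walk.support_reverse, List.mem_reverse] at hw'
    have h1 := hRl w hw
    have h2 := hQo w hw'
    have h3 := hQg w hw'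
    exact hG.dist_eq_zero_iff.1 (by omega)
  have hcycle : (P.append (r.bypass.append Q.reverse)).IsCycle := by
    refine hP.isCycle_append hRQ (fun w hw hw' => ?_) (Or.inl (by omega))
    have hwz : w ≠ z := by
      rintro rfl
      have := hP.support_nodup
      rw [← Walk.cons_tail_support, List.nodup_cons] at this
      exact this.1 hw
    have hwu : w ≠ u := by
      rintro rfl
      have := hRQ.support_nodup
      rw [← Walk.cons_tail_support, List.nodup_cons] at this
      exact this.1 hw'
    have hwP := List.mem_of_mem_tail hw
    have h1 := hPo w hwP
    have h2 := hPg w hwP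
    rcases (Walk.mem_support_append_iff _ _).1 (List.mem_of_mem_tail hw') with hwR | hwQ
    · have h3 := hRl w hwR
      exact hwu (hG.dist_eq_zero_iff.1 (by omega))
    · rw [Walk.support_reverse, List.mem_reverse] at hwQ
      have h3 := hQg w hwQ
      have h4 := hmax w (by omega) (by omega)
      exact hwz (hG.dist_eq_zero_iff.1 (by omega)).symm
  set c := P.append (r.bypass.append Q.reverse) with hc
  have hcl : c.length = t + (r.bypass.length + Q.length) := by
    simp [hc, ht]
  have hεe : ε ≤ e := Nat.le_ceil ε
  -- the cycle is inspected near the vertex of the first leg at distance `m + e + 1` below `u`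
  obtain ⟨a, ha, hsa⟩ := h z c hcycle (by omega) ((t - (m + e + 1) : ℕ) : ℝ)
    (natCast_mem_Icc (by omega))
  obtain ⟨hac, b, hbc, hm, hlt⟩ := exists_of_mem_shortcutVertices ha
  have hnear : a + m + 1 < t ∧ t < a + m + 2 * e + 1 := by
    have hs : ((t - (m + e + 1) : ℕ) : ℝ) = t - (m + e + 1) := by
      rw [Nat.cast_sub (by omega)]
      push_cast
      ring
    rw [hs] at hsa
    have hsmall' : (m + 2 * e + k + 2 : ℝ) ≤ t := by exact_mod_cast not_lt.1 hsmall
    have hN : (2 * t : ℝ) ≤ c.length := by exact_mod_cast (by omega : 2 * t ≤ c.length)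
    have haN : (a : ℝ) ≤ c.length := by exact_mod_cast hac
    have ha0 : (0 : ℝ) ≤ a := by positivity
    have hm0 : (0 : ℝ) ≤ m := by positivity
    have hk0 : (0 : ℝ) ≤ k := by positivity
    have he0 : (0 : ℝ) ≤ e := by positivity
    rw [cycleDist, min_lt_iff] at hsa
    have habs : |(t : ℝ) - (m + e + 1) - a| < e := by
      rcases hsa with hsa | hsa
      · exact hsa.trans_le hεe
      · exfalso
        rcases abs_cases ((t : ℝ) - (m + e + 1) - a) with ⟨h1, -⟩ | ⟨h1, -⟩ <;>
          rw [h1] at hsa <;> linarith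
    rw [abs_lt] at habs
    constructor
    · have : (a : ℝ) + m + 1 < t := by linarith
      exact_mod_cast this
    · have : (t : ℝ) < a + m + 2 * e + 1 := by linarith
      exact_mod_cast this
  have hleg : ∀ i, i ≤ t → c.getVert i = P.getVert i := fun i hi => by
    rw [hc, Walk.getVert_append', if_pos hi]
  have hlegl : ∀ i, i ≤ t → G.dist o (c.getVert i) = G.dist o z + i := fun i hi => by
    rw [hleg i hi, hPo _ (P.getVert_mem_support i),
      (Walk.dist_getVert_of_length_eq_dist hG hPl hi).1]
  have hla := hlegl a (by omega)
  have hab := htri o (c.getVert b) (c.getVert a)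
  have hba := htri o (c.getVert a) (c.getVert b)
  rw [dist_comm (u := c.getVert b) (v := c.getVert a)] at hab
  by_cases hbt : b ≤ t
  · -- the legs are geodesics, so no shortcut joins two vertices of the same leg
    exfalso
    have hlb := hlegl b hbt
    have h1 := cycleDist_le_abs c.length a b
    have h2 : |(a : ℝ) - b| ≤ G.dist (c.getVert a) (c.getVert b) := by
      rw [abs_le]
      constructor
      · have : (b : ℝ) ≤ a + G.dist (c.getVert a) (c.getVert b) := by
          exact_mod_cast (by omega : b ≤ a + G.dist (c.getVert a) (c.getVert b))
        linarith
      · have : (a : ℝ) ≤ b + G.dist (c.getVert a) (c.getVert b) := by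
          exact_mod_cast (by omega : a ≤ b + G.dist (c.getVert a) (c.getVert b))
        linarith
    linarith
  · have hb : c.getVert b ∈ (r.bypass.append Q.reverse).support := by
      rw [hc, Walk.getVert_append', if_neg (by omega)]
      exact Walk.getVert_mem_support _ _
    rcases (Walk.mem_support_append_iff _ _).1 hb with hbR | hbQ
    · have h1 := hRl _ hbR
      omega
    · rw [Walk.support_reverse, List.mem_reverse] at hbQ
      have h1 := hQo _ hbQ
      have h2 := hQg _ hbQ
      have h3 := (Walk.dist_getVert_of_length_eq_dist hG hPl (i := a) (by omega)).2
      rw [← hleg a (by omega), dist_comm (v := u)] at h3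
      have h4 := htri u (c.getVert a) v
      have h5 := htri (c.getVert a) (c.getVert b) v
      omega

end SimpleGraph

theorem IsDenselyChordal.quasiIsometricToTree {V : Type*} {G : SimpleGraph V} (hG : G.Connected)
    {ε : ℝ} {k m : ℕ} (h : IsDenselyChordal G ε k m) : QuasiIsometricToTree G hG := by
  obtain ⟨o⟩ := hG.nonempty
  exact ⟨_, G.layeringTree o, SimpleGraph.layeringTree_isTree hG,
    quasiIsometric_of_vertexMap hG _ (G.cluster o) Quotient.mk_surjective _
      (SimpleGraph.dist_cluster_le hG)
      (SimpleGraph.dist_le_of_cluster_dist_le hG fun _ _ =>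
        SimpleGraph.dist_le_of_cluster_eq hG h)⟩

/-- A connected graph is quasi-isometric to a tree if and only if it is `ε`-densely
`(k, m)`-chordal for some `ε > 0` and `k, m ∈ ℕ`. -/
theorem corollaryC {V : Type*} (G : SimpleGraph V) (hG : G.Connected) :
    QuasiIsometricToTree G hG ↔
      ∃ (ε : ℝ) (k m : ℕ), 0 < ε ∧ 4 ≤ k ∧ 2 * m ≤ k ∧ IsDenselyChordal G ε k m :=
  ⟨fun h => h.exists_isDenselyChordal, fun ⟨_, _, _, _, _, _, h⟩ => h.quasiIsometricToTree hG⟩
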